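/- For partitions identified with their Young diagrams, the hook length of a box is the number of boxes weakly to its right in its row or weakly below it in its column (the box itself counted once). A partition is a $t$-core if none of its boxes has hook length $t$, and a $(2k-1,2k,2k+1)$-core if it is a $t$-core for each $t\in\{2k-1,2k,2k+1\}$. A $(2k-1,2k,2k+1)$-core is maximal if its size is the largest among all $(2k-1,2k,2k+1)$-cores. Theorem. Let $k\ge 1$. Among the maximal $(2k-1,2k,2k+1)$-cores there is exactly one, denoted $\kappa_{2k-1,2k,2k+1}$, with the largest number of parts, and its sequence of parts in decreasing order is $$\kappa_{2k-1,2k,2k+1}=\left(\{(k-1)^2\}^{2},\{(k-2)^2\}^{4},\dots,9^{2k-6},4^{2k-4},1^{2k-2}\right),$$ that is, for $i=1,\dots,k-1$ in this order, the part $(k-i)^2$ is repeated $2i$ times (for $k=1$ this is the empty partition). -/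

import Mathlib

namespace YoungDiagram

/-- The hook of the box `c` in `μ`: the boxes in the same row weakly to the right of `c`
and the boxes in the same column weakly below `c` (so `c` itself is counted once). -/
def hook (μ : YoungDiagram) (c : ℕ × ℕ) : Finset (ℕ × ℕ) :=
  μ.cells.filter fun d => (d.1 = c.1 ∧ c.2 ≤ d.2) ∨ (d.2 = c.2 ∧ c.1 ≤ d.1)

/-- The hook length of the box `c` in `μ`. -/
def hookLength (μ : YoungDiagram) (c : ℕ × ℕ) : ℕ :=
  (μ.hook c).card

/-- `μ` is a `t`-core: no box of `μ` has hook length `t`. -/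
def IsCore (t : ℕ) (μ : YoungDiagram) : Prop :=
  ∀ c ∈ μ, μ.hookLength c ≠ t

/-- `μ` is simultaneously an `r`-core, an `s`-core and a `t`-core. -/
def IsTripleCore (r s t : ℕ) (μ : YoungDiagram) : Prop :=
  μ.IsCore r ∧ μ.IsCore s ∧ μ.IsCore t

/-- `μ` is a maximal `(r, s, t)`-core: one of largest size. -/
def IsMaximalTripleCore (r s t : ℕ) (μ : YoungDiagram) : Prop :=
  μ.IsTripleCore r s t ∧ ∀ ν : YoungDiagram, ν.IsTripleCore r s t → ν.card ≤ μ.card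

/-- The number of parts of the partition whose Young diagram is `μ`. -/
def numParts (μ : YoungDiagram) : ℕ :=
  μ.rowLens.length

/-- `μ` is a maximal `(r, s, t)`-core, and it has the largest number of parts among the
maximal `(r, s, t)`-cores. -/
def IsKappa (r s t : ℕ) (μ : YoungDiagram) : Prop :=
  μ.IsMaximalTripleCore r s t ∧
    ∀ ν : YoungDiagram, ν.IsMaximalTripleCore r s t → ν.numParts ≤ μ.numParts

end YoungDiagram

/-- The list of parts, in decreasing order: `(k-1)^2` repeated `2` times, `(k-2)^2` repeated
`4` times, ..., `1` repeated `2k-2` times. It is empty for `k = 1`. -/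
def squareParts (k : ℕ) : List ℕ :=
  (List.range (k - 1)).flatMap fun i => List.replicate (2 * (i + 1)) ((k - (i + 1)) ^ 2)

/-!
A partition is determined by the set `B` of its first-column hook lengths, and it is a `t`-core
exactly when `b - t ∈ B` for every `b ∈ B` with `t ≤ b` (`YoungDiagram.isCore_iff`). Write
`k = n + 1`. For a `(2 * n + 1, 2 * n + 2, 2 * n + 3)`-core it follows that `B` is contained in the
set `gaps n` of positive integers outside the numerical semigroup generated by these three numbers.
These gaps form a pyramid with rows of `2, 4, ..., 2 * n` consecutive integers, from the top down,
and the sets `B` that occur are its order ideals.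

The full set `gaps n` belongs to the partition `squareParts (n + 1)`. Among all the order ideals it
has strictly the largest cardinality, which is the number of parts. So the theorem follows once this
partition is shown to have the largest size, which is `∑ b ∈ B, b - B.card * (B.card - 1) / 2` in
terms of `B`.

For this, let `v r` be the number of gaps in row `r` that are missing from `B`. The ideal property
gives that some number `q` of top rows are missing entirely and that below them `v` is decreasing
with values in `[0, 2 * q + 1]` (`ClosedUnderSub.missing_succ_le`, `exists_full_prefix`). The loss
in size is at least a quadratic function of `v`, attained when the missing gaps come first in their
rows. With `w = v - q`, twice this quadratic function is a sum of a nonnegative constant, of the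
numbers `2 * w i * (w i - 1)`, which are nonnegative because `w i` is an integer, and, over the
pairs `i < j`, of the numbers
`2 * w i * w j - w i - w j + (2 * n + 3) * (w i - w j)`, which are nonnegative because
`-q ≤ w j ≤ w i ≤ q + 1` (`nonneg_sum_pairs_of_antitone`).
-/

open Finset

/-! ### First-column hook lengths -/

namespace YoungDiagram

/-- The hook length of the box in row `i` and column `0`, written as the row length plus the number
of rows below; only the values at `i < μ.colLen 0` have this meaning. -/
def betaNum (μ : YoungDiagram) (i : ℕ) : ℕ :=
  μ.rowLen i + (μ.colLen 0 - 1 - i)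

/-- The set of first-column hook lengths of `μ`. -/
def betaSet (μ : YoungDiagram) : Finset ℕ :=
  (range (μ.colLen 0)).image μ.betaNum

theorem mem_betaSet {μ : YoungDiagram} {b : ℕ} :
    b ∈ μ.betaSet ↔ ∃ i < μ.colLen 0, μ.betaNum i = b := by
  simp [betaSet]

theorem lt_rowLen_iff_lt_colLen (μ : YoungDiagram) {i j : ℕ} :
    j < μ.rowLen i ↔ i < μ.colLen j := by
  rw [← mem_iff_lt_rowLen, mem_iff_lt_colLen]

theorem rowLen_pos (μ : YoungDiagram) {i : ℕ} (hi : i < μ.colLen 0) : 0 < μ.rowLen i :=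
  μ.lt_rowLen_iff_lt_colLen.2 hi

theorem rowLen_eq_zero (μ : YoungDiagram) {i : ℕ} (hi : μ.colLen 0 ≤ i) : μ.rowLen i = 0 := by
  by_contra h
  have := μ.lt_rowLen_iff_lt_colLen.1 (Nat.pos_of_ne_zero h)
  omega

theorem betaNum_lt (μ : YoungDiagram) {i j : ℕ} (hij : i < j) (hj : j < μ.colLen 0) :
    μ.betaNum j < μ.betaNum i := by
  have := μ.rowLen_anti i j hij.le
  simp only [betaNum]
  omega

theorem betaNum_injOn (μ : YoungDiagram) : Set.InjOn μ.betaNum (range (μ.colLen 0)) := by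
  intro i hi j hj h
  simp only [coe_range, Set.mem_Iio] at hi hj
  rcases lt_trichotomy i j with hij | hij | hij
  · have := μ.betaNum_lt hij hj
    omega
  · exact hij
  · have := μ.betaNum_lt hij hi
    omega

theorem card_betaSet (μ : YoungDiagram) : μ.betaSet.card = μ.colLen 0 := by
  rw [betaSet, card_image_of_injOn μ.betaNum_injOn, card_range]

theorem zero_notMem_betaSet (μ : YoungDiagram) : 0 ∉ μ.betaSet := by
  rw [mem_betaSet]
  rintro ⟨i, hi, h⟩
  have := μ.rowLen_pos hi
  simp only [betaNum] at h
  omega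

theorem card_eq_sum_rowLen (μ : YoungDiagram) :
    μ.card = ∑ i ∈ range (μ.colLen 0), μ.rowLen i := by
  have : μ.cells = (range (μ.colLen 0)).biUnion μ.row := by
    ext ⟨i, j⟩
    simp only [mem_cells, mem_biUnion, mem_range, mem_row_iff]
    constructor
    · intro h
      exact ⟨i, mem_iff_lt_colLen.1 (μ.up_left_mem le_rfl (Nat.zero_le j) h), h, rfl⟩
    · rintro ⟨_, _, h, _⟩
      exact h
  rw [YoungDiagram.card, this, card_biUnion]
  · simp only [rowLen_eq_card]
  · intro i _ j _ hij
    rw [Function.onFun_apply, disjoint_left]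
    rintro ⟨a, b⟩ h1 h2
    rw [mem_row_iff] at h1 h2
    exact hij (h1.2.symm.trans h2.2)

/-- The size of a partition in terms of its first-column hook lengths, which exceed the parts by
`0, 1, 2, ...`, counted from the smallest part. -/
theorem two_mul_card_add (μ : YoungDiagram) :
    2 * (μ.card : ℤ) + μ.betaSet.card * (μ.betaSet.card - 1) = 2 * ∑ b ∈ μ.betaSet, (b : ℤ) := by
  have h : ∑ b ∈ μ.betaSet, b = μ.card + ∑ i ∈ range (μ.colLen 0), i := by
    rw [betaSet, sum_image μ.betaNum_injOn, card_eq_sum_rowLen, ← sum_range_reflect (fun i => i),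
      ← sum_add_distrib]
    rfl
  have h2 : ∀ n : ℕ, 2 * ∑ i ∈ range n, (i : ℤ) = n * (n - 1) := by
    intro n
    induction n with
    | zero => simp
    | succ n ih => rw [sum_range_succ, mul_add, ih]; push_cast; ring
  zify at h
  rw [h, card_betaSet, mul_add, h2]

theorem hookLength_add {μ : YoungDiagram} {i j : ℕ} (h : (i, j) ∈ μ) :
    μ.hookLength (i, j) + i + j + 1 = μ.rowLen i + μ.colLen j := by
  have hr := mem_iff_lt_rowLen.1 h
  have hc := mem_iff_lt_colLen.1 h
  have : μ.hook (i, j) = {i} ×ˢ Ico j (μ.rowLen i) ∪ Ico (i + 1) (μ.colLen j) ×ˢ {j} := by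
    ext ⟨a, b⟩
    simp only [hook, mem_filter, mem_cells, mem_union, mem_product, mem_singleton, mem_Ico]
    constructor
    · rintro ⟨hab, ⟨rfl, hb⟩ | ⟨rfl, ha⟩⟩
      · exact Or.inl ⟨rfl, hb, mem_iff_lt_rowLen.1 hab⟩
      · rcases ha.eq_or_lt with rfl | ha
        · exact Or.inl ⟨rfl, le_rfl, hr⟩
        · exact Or.inr ⟨⟨ha, mem_iff_lt_colLen.1 hab⟩, rfl⟩
    · rintro (⟨rfl, hb, hb'⟩ | ⟨⟨ha, ha'⟩, rfl⟩)
      · exact ⟨mem_iff_lt_rowLen.2 hb', Or.inl ⟨rfl, hb⟩⟩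
      · exact ⟨mem_iff_lt_colLen.2 ha', Or.inr ⟨rfl, by omega⟩⟩
  rw [hookLength, this, card_union_of_disjoint]
  · simp only [card_product, card_singleton, Nat.card_Ico]
    omega
  · rw [disjoint_left]
    rintro ⟨a, b⟩ h1 h2
    simp only [mem_product, mem_singleton, mem_Ico] at h1 h2
    omega

/-- A hook of length `t` whose corner lies in row `i` corresponds to a natural number
`betaNum i - t` missing from the set of first-column hook lengths. -/
theorem isCore_iff {μ : YoungDiagram} {t : ℕ} :
    μ.IsCore t ↔ ∀ b ∈ μ.betaSet, t ≤ b → b - t ∈ μ.betaSet := by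
  constructor
  · intro h b hb htb
    obtain ⟨i, hi, rfl⟩ := mem_betaSet.1 hb
    by_contra hx
    set x := μ.betaNum i - t with hxdef
    have hne : ∀ i' < μ.colLen 0, μ.betaNum i' ≠ x := fun i' hi' he =>
      hx (mem_betaSet.2 ⟨i', hi', he⟩)
    -- `c` is the number of first-column hook lengths exceeding `x`; the box in row `i` and column
    -- `j = x + c - μ.colLen 0` will have hook length `t`, because column `j` has length `c`.
    have hex : ∃ c, μ.colLen 0 ≤ c ∨ μ.betaNum c < x := ⟨_, Or.inl le_rfl⟩
    obtain ⟨c, hc, hmin⟩ : ∃ c, (μ.colLen 0 ≤ c ∨ μ.betaNum c < x) ∧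
        ∀ d < c, d < μ.colLen 0 ∧ x ≤ μ.betaNum d := by
      classical
      refine ⟨Nat.find hex, Nat.find_spec hex, fun d hd => ?_⟩
      have := Nat.find_min hex hd
      push Not at this
      exact this
    have hic : i < c := by
      by_contra hci
      push Not at hci
      rcases hc with hc | hc
      · omega
      · rcases hci.eq_or_lt with rfl | hci
        · omega
        · have := μ.betaNum_lt hci hi
          omega
    have hcl : c ≤ μ.colLen 0 := by
      have := (hmin (c - 1) (by omega)).1
      omega
    obtain ⟨j, hj⟩ : ∃ j, x + c = j + μ.colLen 0 := by
      refine ⟨x + c - μ.colLen 0, ?_⟩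
      rcases hc with hc | hc
      · omega
      · rcases hcl.eq_or_lt with rfl | hcl
        · omega
        · have := μ.rowLen_pos hcl
          simp only [betaNum] at hc
          omega
    have hcol : μ.colLen j = c := by
      apply le_antisymm
      · rw [← not_lt, ← lt_rowLen_iff_lt_colLen, not_lt]
        rcases hcl.eq_or_lt with he | hcl
        · rw [μ.rowLen_eq_zero he.ge]
          omega
        · have hc := hc.resolve_left (by omega)
          simp only [betaNum] at hc
          omega
      · have h1 := hmin (c - 1) (by omega)
        have h2 := hne _ h1.1
        have : c - 1 < μ.colLen j := by
          rw [← lt_rowLen_iff_lt_colLen]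
          simp only [betaNum] at h1 h2
          omega
        omega
    have hmem : (i, j) ∈ μ := mem_iff_lt_colLen.2 (hcol ▸ hic)
    have := hookLength_add hmem
    refine h _ hmem ?_
    simp only [betaNum] at hxdef htb
    omega
  · rintro h ⟨i, j⟩ hmem rfl
    have hlen := hookLength_add hmem
    have hi : i < μ.colLen 0 := mem_iff_lt_colLen.1 (μ.up_left_mem le_rfl (Nat.zero_le j) hmem)
    have hc := μ.colLen_anti 0 j (Nat.zero_le j)
    have hij := mem_iff_lt_colLen.1 hmem
    obtain ⟨i', hi', he⟩ := mem_betaSet.1 (h _ (mem_betaSet.2 ⟨i, hi, rfl⟩)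
      (by simp only [betaNum]; omega))
    have := μ.lt_rowLen_iff_lt_colLen (i := i') (j := j)
    simp only [betaNum] at he
    omega

/-- A Young diagram is determined by its first-column hook lengths. -/
theorem betaSet_injective : Function.Injective betaSet := by
  intro μ ν h
  have hl : μ.colLen 0 = ν.colLen 0 := by rw [← card_betaSet, h, card_betaSet]
  have anti : ∀ (ξ : YoungDiagram) (l : ℕ), ξ.colLen 0 = l →
      StrictAnti (fun i : Fin l => ξ.betaNum i) := by
    rintro ξ l rfl i j hij
    exact ξ.betaNum_lt hij j.2
  have hr : ∀ (ξ : YoungDiagram) (l : ℕ), ξ.colLen 0 = l →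
      Set.range (fun i : Fin l => ξ.betaNum i) = ξ.betaSet := by
    rintro ξ l rfl
    ext b
    simp only [Set.mem_range, mem_coe, mem_betaSet]
    exact ⟨fun ⟨i, hi⟩ => ⟨i, i.2, hi⟩, fun ⟨i, hi, hb⟩ => ⟨⟨i, hi⟩, hb⟩⟩
  have hfun := (StrictAnti.range_inj (anti μ _ hl) (anti ν _ rfl)).1
    (by rw [hr _ _ hl, hr _ _ rfl, h])
  have hrow : ∀ i, μ.rowLen i = ν.rowLen i := by
    intro i
    by_cases hi : i < ν.colLen 0
    · have := congrFun hfun ⟨i, hi⟩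
      simp only [betaNum] at this
      omega
    · rw [μ.rowLen_eq_zero (by omega), ν.rowLen_eq_zero (by omega)]
  ext ⟨i, j⟩
  rw [mem_cells, mem_cells, mem_iff_lt_rowLen, mem_iff_lt_rowLen, hrow]

end YoungDiagram

/-! ### An inequality for row lengths -/

/-- The right-hand side is the sum over all pairs `i < j` of
`2 * w i * w j - w i - w j + C * (w i - w j)`, and each of these terms is nonnegative. -/
theorem nonneg_sum_pairs_of_antitone (C q : ℤ) (hq : 0 ≤ q) (hC : 2 * q + 1 ≤ C)
    (p : ℕ) (w : ℕ → ℤ) (hanti : ∀ i j, i ≤ j → j < p → w j ≤ w i)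
    (hlo : ∀ i < p, -q ≤ w i) (hhi : ∀ i < p, w i ≤ q + 1) :
    0 ≤ (∑ i ∈ range p, w i) * (∑ i ∈ range p, w i - p) + C * ∑ i ∈ range p, (p - 1 - 2 * i) * w i
      - ∑ i ∈ range p, w i * (w i - 1) := by
  induction p with
  | zero => simp
  | succ p ih =>
    have ih := ih (fun i j hij hj => hanti i j hij (by omega)) (fun i hi => hlo i (by omega))
      (fun i hi => hhi i (by omega))
    have step : 0 ≤ ∑ i ∈ range p, (2 * w i * w p - w i - w p + C * (w i - w p)) := by
      refine sum_nonneg fun i hi => ?_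
      have hi := mem_range.1 hi
      have h1 := hanti i p hi.le (by omega)
      have h2 := hlo p (by omega)
      have h3 := hhi i (by omega)
      -- The summand equals `2 b (a - 1) + (C - 1) (a - b)` with `a = w i` and `b = w p`.
      have h4 : 0 ≤ (C - 1 - 2 * q) * (w i - w p) := mul_nonneg (by omega) (by omega)
      rcases le_or_gt 0 (w p) with hb | hb
      · rcases le_or_gt 1 (w i) with ha | ha
        · nlinarith [mul_nonneg hb (sub_nonneg.2 ha), mul_nonneg hq (sub_nonneg.2 h1)]
        · have ha0 : w i = 0 := by omega
          have hb0 : w p = 0 := by omega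
          simp [ha0, hb0]
      · rcases le_or_gt 1 (w i) with ha | ha
        · nlinarith [mul_nonneg (show 0 ≤ w p + q by omega) (sub_nonneg.2 ha),
            mul_nonneg hq (show 0 ≤ 1 - w p by omega)]
        · nlinarith [mul_nonneg (show 0 ≤ -w p by omega) (show 0 ≤ 1 - w i by omega),
            mul_nonneg hq (sub_nonneg.2 h1)]
    have e1 : ∑ i ∈ range p, (2 * w i * w p - w i - w p + C * (w i - w p)) =
        2 * (∑ i ∈ range p, w i) * w p - ∑ i ∈ range p, w i - p * w p
          + C * (∑ i ∈ range p, w i - p * w p) := by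
      simp only [sum_add_distrib, sum_sub_distrib, ← mul_sum, ← sum_mul, sum_const, card_range,
        nsmul_eq_mul]
    have e2 : ∑ i ∈ range p, (((p + 1 : ℕ) : ℤ) - 1 - 2 * i) * w i =
        ∑ i ∈ range p, ((p : ℤ) - 1 - 2 * i) * w i + ∑ i ∈ range p, w i := by
      rw [← sum_add_distrib]
      refine sum_congr rfl fun i _ => ?_
      push_cast
      ring
    rw [e1] at step
    rw [sum_range_succ, sum_range_succ, sum_range_succ, e2]
    push_cast
    linear_combination ih + step

/-- If `v r` elements are removed from row `r` of the pyramid of gaps, starting with the smallest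
ones of the row, then the size of the associated partition does not increase. Here the top `q` rows
are removed entirely and `v` decreases below them; the substitution `w = v - q` makes the quadratic
form in the remaining rows one to which `nonneg_sum_pairs_of_antitone` applies. -/
theorem two_mul_sum_mul_le_of_rows (n q p : ℕ) (hn : n = q + p) (v : ℕ → ℤ)
    (hfull : ∀ r < q, v r = 2 * (r + 1))
    (hanti : ∀ i j, q ≤ i → i ≤ j → j < n → v j ≤ v i)
    (hlo : ∀ r < n, 0 ≤ v r) (hhi : ∀ r, q ≤ r → r < n → v r ≤ 2 * q + 1) :
    2 * (∑ r ∈ range n, v r) * (n * (n + 1)) ≤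
      ∑ r ∈ range n, (2 * (n - 1 - r) * (2 * n + 3) * v r + v r * (v r + 1))
        + (∑ r ∈ range n, v r) * (∑ r ∈ range n, v r + 1) := by
  subst hn
  set w : ℕ → ℤ := fun t => v (q + t) - q with hw
  have key := nonneg_sum_pairs_of_antitone (2 * (q + p : ℕ) + 3) q (by omega)
    (by push_cast; omega) p w
    (fun i j hij hj => by
      have := hanti (q + i) (q + j) (by omega) (by omega) (by omega)
      simp only [hw]
      omega)
    (fun i hi => by have := hlo (q + i) (by omega); simp only [hw]; omega)
    (fun i hi => by have := hhi (q + i) (by omega) (by omega); simp only [hw]; omega)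
  have hsq : 0 ≤ ∑ i ∈ range p, w i * (w i - 1) := sum_nonneg fun i _ => by
    rcases le_or_gt (w i) 0 with h | h <;> nlinarith
  -- `f1` to `f5` evaluate the sums: the full rows in closed form, the other ones through `w`.
  have f1 : ∀ q : ℕ, ∑ r ∈ range q, (2 * ((r : ℤ) + 1)) = q * (q + 1) := by
    intro q
    induction q with
    | zero => simp
    | succ q ih => rw [sum_range_succ, ih]; push_cast; ring
  have f2 : ∀ (q : ℕ) (A B : ℤ), 3 * ∑ r ∈ range q,
      (2 * (A - r) * B * (2 * ((r : ℤ) + 1)) + (2 * ((r : ℤ) + 1)) * (2 * ((r : ℤ) + 1) + 1)) =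
      q * (q + 1) * (6 * A * B - 4 * B * (q - 1) + 4 * q + 5) := by
    intro q A B
    induction q with
    | zero => simp
    | succ q ih => rw [sum_range_succ, mul_add, ih]; push_cast; ring
  have f3 : ∑ r ∈ range (q + p), v r = q * (q + 1) + (∑ i ∈ range p, w i + p * q) := by
    rw [sum_range_add, sum_congr rfl (fun r hr => hfull r (mem_range.1 hr)), f1]
    simp [hw, sum_sub_distrib]
  have f4 : ∀ p : ℕ, ∑ t ∈ range p, 2 * ((p : ℤ) - 1 - t) = p * (p - 1) := by
    intro p
    have : ∀ (A : ℤ), ∑ t ∈ range p, 2 * (A - t) = p * (2 * A + 1 - p) := by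
      intro A
      induction p with
      | zero => simp
      | succ q ih => rw [sum_range_succ, ih]; push_cast; ring
    rw [this]
    ring
  have f5 : ∑ r ∈ range (q + p), (2 * (((q + p : ℕ) : ℤ) - 1 - r) * (2 * (q + p : ℕ) + 3) * v r
        + v r * (v r + 1)) =
      ∑ r ∈ range q, (2 * (((q + p : ℕ) : ℤ) - 1 - r) * (2 * (q + p : ℕ) + 3) * (2 * ((r : ℤ) + 1))
        + (2 * ((r : ℤ) + 1)) * (2 * ((r : ℤ) + 1) + 1)) +
      ((2 * (q + p : ℕ) + 3) * (∑ i ∈ range p, ((p : ℤ) - 1 - 2 * i) * w i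
        + (p - 1) * ∑ i ∈ range p, w i + q * (p * (p - 1)))
        + ∑ i ∈ range p, w i * (w i - 1) + (2 * q + 2) * ∑ i ∈ range p, w i + p * (q * (q + 1))) := by
    rw [sum_range_add, sum_congr rfl (fun r hr => by rw [hfull r (mem_range.1 hr)])]
    congr 1
    have e : (p : ℤ) * (q * (q + 1)) = ∑ i ∈ range p, (q : ℤ) * (q + 1) := by simp
    rw [← f4, e, mul_sum, mul_sum, mul_sum, ← sum_add_distrib, ← sum_add_distrib, mul_sum,
      ← sum_add_distrib, ← sum_add_distrib, ← sum_add_distrib]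
    refine sum_congr rfl fun i _ => ?_
    simp only [hw]
    push_cast
    ring
  rw [f5, f3]
  have f6 := f2 q (((q + p : ℕ) : ℤ) - 1) (2 * (q + p : ℕ) + 3)
  have pos : (0 : ℤ) ≤ q * (q + 1) * (3 * p ^ 2 + p * (4 * q + 5) + (q + 1) * (q + 2)) := by
    positivity
  generalize ∑ r ∈ range q, (2 * (((q + p : ℕ) : ℤ) - 1 - r) * (2 * (q + p : ℕ) + 3)
    * (2 * ((r : ℤ) + 1)) + (2 * ((r : ℤ) + 1)) * (2 * ((r : ℤ) + 1) + 1)) = T at *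
  push_cast at *
  refine le_of_mul_le_mul_left ?_ (show (0 : ℤ) < 3 by norm_num)
  linear_combination 3 * key + pos + 6 * hsq - f6

/-! ### The gaps of the numerical semigroup -/

/-- The element at position `j` of row `r` of the pyramid `gaps n`. The row `r = 0` is the top one,
which contains the largest numbers; the subtraction is exact for `r < n`, the only rows in use. -/
def gapAt (n r j : ℕ) : ℕ :=
  (n - 1 - r) * (2 * n + 3) + j

/-- The positive integers that are not sums of elements of `{2 * n + 1, 2 * n + 2, 2 * n + 3}`,
arranged in `n` rows: row `r`, counted from the top, consists of `2 * (r + 1)` consecutive numbers. -/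
def gaps (n : ℕ) : Finset ℕ :=
  ((range n).sigma fun r => Icc 1 (2 * (r + 1))).image fun x => gapAt n x.1 x.2

theorem mem_gaps {n b : ℕ} :
    b ∈ gaps n ↔ ∃ r < n, ∃ j, (1 ≤ j ∧ j ≤ 2 * (r + 1)) ∧ gapAt n r j = b := by
  simp [gaps, and_assoc]

theorem gapAt_succ {n r : ℕ} (hr : r + 1 < n) (j : ℕ) :
    gapAt n r j = gapAt n (r + 1) j + (2 * n + 3) := by
  have : n - 1 - r = (n - 1 - (r + 1)) + 1 := by omega
  rw [gapAt, gapAt, this]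
  ring

theorem sum_gaps {M : Type*} [AddCommMonoid M] (n : ℕ) (f : ℕ → M) :
    ∑ x ∈ gaps n, f x = ∑ r ∈ range n, ∑ j ∈ Icc 1 (2 * (r + 1)), f (gapAt n r j) := by
  rw [gaps, sum_image, sum_sigma]
  rintro ⟨r, j⟩ h ⟨r', j'⟩ h' he
  simp only [coe_sigma, Set.mem_sigma_iff, mem_coe, mem_range, mem_Icc] at h h'
  simp only [gapAt] at he
  have hdiv : ∀ r j : ℕ, r < n → j ≤ 2 * (r + 1) →
      ((n - 1 - r) * (2 * n + 3) + j) / (2 * n + 3) = n - 1 - r := by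
    intro r j hr hj
    rw [mul_comm, Nat.mul_add_div (by omega), Nat.div_eq_of_lt (by omega), add_zero]
  have h1 := hdiv r j h.1 h.2.2
  rw [he, hdiv r' j' h'.1 h'.2.2] at h1
  obtain rfl : r = r' := by omega
  obtain rfl : j = j' := by omega
  rfl

theorem card_gaps (n : ℕ) : (gaps n).card = n * (n + 1) := by
  rw [card_eq_sum_ones, sum_gaps]
  simp only [sum_const, smul_eq_mul, mul_one, Nat.card_Icc, Nat.add_sub_cancel]
  induction n with
  | zero => simp
  | succ n ih => rw [sum_range_succ, ih]; ring

theorem sub_mem_gaps {n b s : ℕ} (hs : s ≤ 2) (hb : b ∈ gaps n) (h : 2 * n + 3 - s ≤ b) :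
    b - (2 * n + 3 - s) ∈ gaps n := by
  obtain ⟨r, hr, j, hj, rfl⟩ := mem_gaps.1 hb
  by_cases hr' : r + 1 < n
  · refine mem_gaps.2 ⟨r + 1, hr', j + s, by omega, ?_⟩
    rw [gapAt_succ hr', gapAt, gapAt]
    omega
  · have : n - 1 - r = 0 := by omega
    rw [gapAt, this] at h
    omega

/-- `B` is the set of first-column hook lengths of a `(2 * n + 1, 2 * n + 2, 2 * n + 3)`-core: it
omits `0` and is closed under subtracting `2 * n + 3 - s` for `s = 0, 1, 2`. -/
def ClosedUnderSub (n : ℕ) (B : Finset ℕ) : Prop :=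
  0 ∉ B ∧ ∀ s ≤ 2, ∀ b ∈ B, 2 * n + 3 - s ≤ b → b - (2 * n + 3 - s) ∈ B

theorem ClosedUnderSub.mem_of_add {n : ℕ} {B : Finset ℕ} (h : ClosedUnderSub n B) {x s : ℕ}
    (hs : s ≤ 2) (hx : x + (2 * n + 3 - s) ∈ B) : x ∈ B := by
  simpa using h.2 s hs _ hx (Nat.le_add_left _ _)

/-- Going down one row from a position `j` in `B` reaches the positions `j`, `j + 1` and `j + 2`, so
each row has to be shorter by `2` than the one below it. -/
theorem ClosedUnderSub.subset_gaps {n : ℕ} {B : Finset ℕ} (h : ClosedUnderSub n B) :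
    B ⊆ gaps n := by
  have key : ∀ a j, j < 2 * n + 3 → a * (2 * n + 3) + j ∈ B → 1 ≤ j ∧ j + 2 * a ≤ 2 * n := by
    intro a
    induction a with
    | zero =>
      intro j hj hB
      rw [zero_mul, zero_add] at hB
      have h1 : j ≠ 0 := by
        rintro rfl
        exact h.1 hB
      have h2 : ∀ s ≤ 2, j ≠ 2 * n + 3 - s := by
        rintro s hs rfl
        exact h.1 (h.mem_of_add (x := 0) hs (by rwa [zero_add]))
      have := h2 1 (by omega)
      have := h2 2 (by omega)
      omega
    | succ a ih =>
      intro j hj hB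
      have h0 := ih j hj (h.mem_of_add (s := 0) (by omega) (by convert hB using 1; simp; ring))
      have e : ∀ s ≤ 2, (a + 1) * (2 * n + 3) + j = a * (2 * n + 3) + (j + s) + (2 * n + 3 - s) := by
        intro s hs
        rw [add_mul]
        omega
      have h1 := ih (j + 1) (by omega) (h.mem_of_add (s := 1) (by omega) (by rwa [← e 1 (by omega)]))
      have h2 := ih (j + 2) (by omega) (h.mem_of_add (s := 2) (by omega) (by rwa [← e 2 (by omega)]))
      omega
  intro b hb
  have hk := key (b / (2 * n + 3)) (b % (2 * n + 3)) (Nat.mod_lt _ (by omega))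
    (by rwa [Nat.div_add_mod'])
  refine mem_gaps.2 ⟨n - 1 - b / (2 * n + 3), by omega, b % (2 * n + 3), by omega, ?_⟩
  rw [gapAt, show n - 1 - (n - 1 - b / (2 * n + 3)) = b / (2 * n + 3) by omega, Nat.div_add_mod']

/-! ### Maximality of the full set of gaps -/

theorem card_mul_card_add_one_le (S : Finset ℕ) (hS : ∀ x ∈ S, 1 ≤ x) :
    S.card * (S.card + 1) ≤ 2 * ∑ x ∈ S, x := by
  induction S using Finset.induction_on_max with
  | empty => simp
  | insert a S hlt ih =>
    have ha : a ∉ S := fun h => (hlt a h).false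
    have hcard : S.card + 1 ≤ a := by
      have : S ⊆ Ico 1 a := fun x hx => mem_Ico.2 ⟨hS x (mem_insert_of_mem hx), hlt x hx⟩
      have := card_le_card this
      have := hS a (mem_insert_self _ _)
      simp only [Nat.card_Ico] at *
      omega
    have := ih fun x hx => hS x (mem_insert_of_mem hx)
    rw [card_insert_of_notMem ha, sum_insert ha]
    linarith

/-- The number of elements of row `r` of `gaps n` that do not lie in `B`. -/
def missing (n : ℕ) (B : Finset ℕ) (r : ℕ) : ℕ :=
  ((Icc 1 (2 * (r + 1))).filter fun j => gapAt n r j ∉ B).card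

theorem card_filter_add_missing (n : ℕ) (B : Finset ℕ) (r : ℕ) :
    ((Icc 1 (2 * (r + 1))).filter fun j => gapAt n r j ∈ B).card + missing n B r = 2 * (r + 1) := by
  rw [missing, card_filter_add_card_filter_not]
  simp

/-- A nonempty set `S` of positions in `B` in one row puts `S`, `S + 1` and `S + 2` into the row
below, hence at least two more positions than `S`, which offsets the greater length of that row. -/
theorem ClosedUnderSub.missing_succ_le {n : ℕ} {B : Finset ℕ} (h : ClosedUnderSub n B) {r : ℕ}
    (hr : r + 1 < n) (hlt : missing n B r < 2 * (r + 1)) :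
    missing n B (r + 1) ≤ missing n B r := by
  have c1 := card_filter_add_missing n B r
  have c2 := card_filter_add_missing n B (r + 1)
  set S := (Icc 1 (2 * (r + 1))).filter fun j => gapAt n r j ∈ B with hS
  set T := (Icc 1 (2 * (r + 1 + 1))).filter fun j => gapAt n (r + 1) j ∈ B with hT
  have hne : S.Nonempty := card_pos.1 (by omega)
  have hmem : ∀ j ∈ S, ∀ s ≤ 2, j + s ∈ T := by
    intro j hj s hs
    rw [hS, mem_filter, mem_Icc] at hj
    rw [hT, mem_filter, mem_Icc]
    refine ⟨by omega, h.mem_of_add hs ?_⟩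
    convert hj.2 using 1
    rw [gapAt_succ hr, gapAt, gapAt]
    omega
  have hmax := S.max'_mem hne
  have hle : ∀ j ∈ S, j ≤ S.max' hne := fun j hj => S.le_max' j hj
  generalize S.max' hne = m at hmax hle
  have h1 : m + 1 ∉ S := fun hm => by have := hle _ hm; omega
  have h2 : m + 2 ∉ insert (m + 1) S := fun hm => by
    rcases mem_insert.1 hm with hm | hm
    · omega
    · have := hle _ hm
      omega
  have hsub : insert (m + 2) (insert (m + 1) S) ⊆ T := by
    intro j hj
    rcases mem_insert.1 hj with rfl | hj
    · exact hmem _ hmax 2 le_rfl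
    rcases mem_insert.1 hj with rfl | hj
    · exact hmem _ hmax 1 (by omega)
    · exact hmem _ hj 0 (by omega)
  have := card_le_card hsub
  rw [card_insert_of_notMem h2, card_insert_of_notMem h1] at this
  omega

/-- The rows that are missing entirely are the top `q` ones; below them the number of missing
elements decreases. -/
theorem exists_full_prefix (n : ℕ) (v : ℕ → ℕ) (hv : ∀ r, v r ≤ 2 * (r + 1))
    (hstep : ∀ r, r + 1 < n → v r < 2 * (r + 1) → v (r + 1) ≤ v r) :
    ∃ q ≤ n, (∀ r < q, v r = 2 * (r + 1)) ∧ (∀ i j, q ≤ i → i ≤ j → j < n → v j ≤ v i) ∧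
      ∀ r, q ≤ r → r < n → v r ≤ 2 * q + 1 := by
  classical
  by_cases hall : ∀ r < n, v r = 2 * (r + 1)
  · exact ⟨n, le_rfl, hall, fun i j _ _ _ => by omega, fun r _ _ => by omega⟩
  push Not at hall
  have hspec := Nat.find_spec hall
  have hmin := fun {m} => Nat.find_min hall (m := m)
  generalize Nat.find hall = q at hspec hmin
  have hanti : ∀ i, q ≤ i → i < n → v i < 2 * (i + 1) ∧ ∀ l, q ≤ l → l ≤ i → v i ≤ v l := by
    intro i hqi
    induction i, hqi using Nat.le_induction with
    | base =>
      intro _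
      have := hv q
      refine ⟨by omega, fun l h1 h2 => ?_⟩
      obtain rfl : l = q := by omega
      exact le_rfl
    | succ i hqi ih =>
      intro hi
      obtain ⟨ih1, ih2⟩ := ih (by omega)
      have := hstep i hi ih1
      refine ⟨by omega, fun l h1 h2 => ?_⟩
      rcases h2.eq_or_lt with rfl | h2
      · exact le_rfl
      · exact this.trans (ih2 l h1 (by omega))
  refine ⟨q, hspec.1.le, fun r hr => ?_, fun i j h1 h2 h3 => (hanti j (by omega) h3).2 i h1 h2,
    fun r h1 h2 => ?_⟩
  · by_contra hne
    exact hmin hr ⟨by omega, hne⟩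
  · have := (hanti r h1 h2).2 q le_rfl h1
    have := (hanti q le_rfl hspec.1).1
    omega

/-- Removing the complement of `B` from `gaps n` does not increase the size of the partition. For a
given number of missing elements in a row, their sum is least when they come first. -/
theorem ClosedUnderSub.two_mul_sum_sdiff {n : ℕ} {B : Finset ℕ} (h : ClosedUnderSub n B) :
    2 * ((gaps n \ B).card : ℤ) * (n * (n + 1)) ≤
      2 * ∑ x ∈ gaps n \ B, (x : ℤ) + (gaps n \ B).card * ((gaps n \ B).card + 1) := by
  have hsum : ∀ f : ℕ → ℤ, ∑ x ∈ gaps n \ B, f x =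
      ∑ r ∈ range n, ∑ j ∈ Icc 1 (2 * (r + 1)) with gapAt n r j ∉ B, f (gapAt n r j) := by
    intro f
    rw [sdiff_eq_filter, sum_filter, sum_gaps]
    simp only [sum_filter]
  have hcard : ((gaps n \ B).card : ℤ) = ∑ r ∈ range n, (missing n B r : ℤ) := by
    have := hsum fun _ => 1
    simpa [missing] using this
  obtain ⟨q, hq, hfull, hanti, hhi⟩ := exists_full_prefix n (missing n B)
    (fun r => by have := card_filter_add_missing n B r; omega)
    (fun r hr hlt => h.missing_succ_le hr hlt)
  have key := two_mul_sum_mul_le_of_rows n q (n - q) (by omega) (fun r => missing n B r)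
    (fun r hr => by rw [hfull r hr]; push_cast; ring)
    (fun i j h1 h2 h3 => by exact_mod_cast hanti i j h1 h2 h3)
    (fun r _ => by positivity) (fun r h1 h2 => by exact_mod_cast hhi r h1 h2)
  rw [hcard]
  refine key.trans (add_le_add_left ?_ _)
  rw [hsum, mul_sum]
  refine sum_le_sum fun r hr => ?_
  have hr := mem_range.1 hr
  have hrow := card_mul_card_add_one_le ((Icc 1 (2 * (r + 1))).filter fun j => gapAt n r j ∉ B)
    (fun j hj => (mem_Icc.1 (mem_filter.1 hj).1).1)
  have hshift : ∀ S : Finset ℕ, ∑ j ∈ S, (gapAt n r j : ℤ) =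
      S.card * ((n - 1 - r) * (2 * n + 3)) + ∑ j ∈ S, (j : ℤ) := by
    intro S
    simp only [gapAt, Nat.sub_sub, Nat.cast_add, Nat.cast_mul,
      Nat.cast_sub (show 1 + r ≤ n by omega), sum_add_distrib, sum_const, nsmul_eq_mul]
    push_cast
    ring
  rw [hshift, missing]
  zify at hrow
  linear_combination hrow

/-- Twice the size of the partition with first-column hook lengths `B` is largest for
`B = gaps n`. -/
theorem ClosedUnderSub.two_mul_sum_sub_le {n : ℕ} {B : Finset ℕ} (h : ClosedUnderSub n B) :
    2 * ∑ b ∈ B, (b : ℤ) - B.card * (B.card - 1) ≤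
      2 * ∑ b ∈ gaps n, (b : ℤ) - (gaps n).card * ((gaps n).card - 1) := by
  have key := h.two_mul_sum_sdiff
  have hs := sum_sdiff (f := fun b : ℕ => (b : ℤ)) h.subset_gaps
  have hc := card_sdiff_add_card_eq_card h.subset_gaps
  have hN := card_gaps n
  zify at hc hN
  rw [← hN, ← hc] at key
  rw [← hs, ← hc]
  linear_combination key

/-! ### Triple cores and their first-column hook lengths -/

namespace YoungDiagram

theorem isTripleCore_iff {n : ℕ} {μ : YoungDiagram} :
    μ.IsTripleCore (2 * (n + 1) - 1) (2 * (n + 1)) (2 * (n + 1) + 1) ↔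
      ClosedUnderSub n μ.betaSet := by
  simp only [IsTripleCore, isCore_iff]
  constructor
  · rintro ⟨h1, h2, h3⟩
    refine ⟨μ.zero_notMem_betaSet, fun s hs => ?_⟩
    interval_cases s
    · exact h3
    · exact h2
    · exact h1
  · rintro ⟨-, h⟩
    exact ⟨h 2 le_rfl, h 1 (by omega), h 0 (by omega)⟩

theorem card_le_of_betaSet_eq_gaps {n : ℕ} {κ μ : YoungDiagram} (hκ : κ.betaSet = gaps n)
    (hμ : ClosedUnderSub n μ.betaSet) : μ.card ≤ κ.card := by
  have h1 := κ.two_mul_card_add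
  have h2 := μ.two_mul_card_add
  have h3 := hμ.two_mul_sum_sub_le
  rw [hκ] at h1
  zify
  linarith

theorem numParts_eq_card_betaSet (μ : YoungDiagram) : μ.numParts = μ.betaSet.card := by
  rw [numParts, length_rowLens, card_betaSet]

/-- The full set `gaps n` has the largest cardinality among the closed sets, so no other maximal core
has as many parts. -/
theorem isKappa_iff_betaSet_eq_gaps {n : ℕ} (hex : ∃ κ : YoungDiagram, κ.betaSet = gaps n)
    {μ : YoungDiagram} :
    μ.IsKappa (2 * (n + 1) - 1) (2 * (n + 1)) (2 * (n + 1) + 1) ↔ μ.betaSet = gaps n := by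
  have hmax : ∀ κ : YoungDiagram, κ.betaSet = gaps n →
      κ.IsMaximalTripleCore (2 * (n + 1) - 1) (2 * (n + 1)) (2 * (n + 1) + 1) := by
    refine fun κ hκ => ⟨isTripleCore_iff.2 ⟨κ.zero_notMem_betaSet, fun s hs b hb => ?_⟩,
      fun ν hν => card_le_of_betaSet_eq_gaps hκ (isTripleCore_iff.1 hν)⟩
    rw [hκ] at hb ⊢
    exact sub_mem_gaps hs hb
  constructor
  · rintro ⟨hμ, hparts⟩
    obtain ⟨κ, hκ⟩ := hex
    have := hparts κ (hmax κ hκ)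
    rw [numParts_eq_card_betaSet, numParts_eq_card_betaSet, hκ] at this
    exact eq_of_subset_of_card_le (isTripleCore_iff.1 hμ.1).subset_gaps this
  · intro hμ
    refine ⟨hmax μ hμ, fun ν hν => ?_⟩
    rw [numParts_eq_card_betaSet, numParts_eq_card_betaSet, hμ]
    exact card_le_card (isTripleCore_iff.1 hν.1).subset_gaps

theorem rowLen_of_getElem?_rowLens {μ : YoungDiagram} {i x : ℕ} (h : μ.rowLens[i]? = some x) :
    i < μ.colLen 0 ∧ μ.rowLen i = x := by
  obtain ⟨hi, hx⟩ := List.getElem?_eq_some_iff.1 h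
  rw [get_rowLens] at hx
  exact ⟨by rwa [length_rowLens] at hi, hx⟩

end YoungDiagram

/-! ### The partition into squares -/

theorem length_flatMap_replicate (F : ℕ → ℕ) (n : ℕ) :
    ((List.range n).flatMap fun i => List.replicate (2 * (i + 1)) (F i)).length = n * (n + 1) := by
  induction n with
  | zero => simp
  | succ n ih =>
    rw [List.range_succ, List.flatMap_append, List.length_append, ih]
    simp only [List.flatMap_cons, List.flatMap_nil, List.append_nil, List.length_replicate]
    ring

/-- The blocks before block `i` have total length `i * (i + 1)`. -/
theorem getElem?_flatMap_replicate (F : ℕ → ℕ) {n i e : ℕ} (hi : i < n) (he : e < 2 * (i + 1)) :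
    ((List.range n).flatMap fun i => List.replicate (2 * (i + 1)) (F i))[i * (i + 1) + e]? =
      some (F i) := by
  induction n with
  | zero => omega
  | succ n ih =>
    rw [List.range_succ, List.flatMap_append]
    rcases (Nat.lt_succ_iff.1 hi).eq_or_lt with rfl | hi
    · rw [List.getElem?_append_right (by rw [length_flatMap_replicate]; omega),
        length_flatMap_replicate, Nat.add_sub_cancel_left]
      simp only [List.flatMap_cons, List.flatMap_nil, List.append_nil]
      rw [List.getElem?_replicate, if_pos he]
    · rw [List.getElem?_append_left, ih hi]
      rw [length_flatMap_replicate]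
      nlinarith [Nat.mul_le_mul hi hi]

theorem squareParts_sortedGE (k : ℕ) : (squareParts k).SortedGE := by
  refine List.Pairwise.sortedGE ?_
  rw [squareParts, List.pairwise_flatMap]
  refine ⟨fun i _ => List.pairwise_replicate.2 (Or.inr le_rfl), ?_⟩
  refine List.pairwise_lt_range.imp fun {a b} hab x hx y hy => ?_
  rw [List.eq_of_mem_replicate hx, List.eq_of_mem_replicate hy]
  exact Nat.pow_le_pow_left (by omega) 2

theorem squareParts_pos (k : ℕ) : ∀ x ∈ squareParts k, 0 < x := by
  intro x hx
  obtain ⟨i, hi, hx⟩ := List.mem_flatMap.1 hx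
  rw [List.mem_range] at hi
  rw [List.eq_of_mem_replicate hx]
  exact pow_pos (by omega) 2

theorem betaSet_eq_gaps_of_rowLens {n : ℕ} {κ : YoungDiagram}
    (h : κ.rowLens = squareParts (n + 1)) :
    κ.betaSet = gaps n := by
  have hcol : κ.colLen 0 = n * (n + 1) := by
    rw [← YoungDiagram.length_rowLens, h, squareParts, length_flatMap_replicate, Nat.add_sub_cancel]
  refine (eq_of_subset_of_card_le (fun x hx => ?_) ?_).symm
  · obtain ⟨r, hr, j, hj, rfl⟩ := mem_gaps.1 hx
    obtain ⟨hlt, hrow⟩ := YoungDiagram.rowLen_of_getElem?_rowLens (μ := κ)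
      (x := (n + 1 - (r + 1)) ^ 2) (i := r * (r + 1) + (2 * (r + 1) - j))
      (by rw [h]; exact getElem?_flatMap_replicate _ hr (by omega))
    refine YoungDiagram.mem_betaSet.2 ⟨_, hlt, ?_⟩
    rw [YoungDiagram.betaNum, hrow, gapAt]
    rw [hcol] at hlt ⊢
    -- The part in position `e` of block `r` corresponds to the position `2 * (r + 1) - e` of row `r`.
    obtain ⟨d, rfl⟩ := Nat.exists_eq_add_of_lt hr
    obtain ⟨e, he⟩ := Nat.exists_eq_add_of_le hj.2
    rw [show r + d + 1 + 1 - (r + 1) = d + 1 by omega, show r + d + 1 - 1 - r = d by omega]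
    rw [show 2 * (r + 1) - j = e by omega] at *
    zify [show r * (r + 1) + e ≤ (r + d + 1) * (r + d + 1 + 1) - 1 by omega,
      show 1 ≤ (r + d + 1) * (r + d + 1 + 1) by omega] at he ⊢
    linear_combination he
  · rw [κ.card_betaSet, hcol, card_gaps]

theorem theorem4 (k : ℕ) (hk : 1 ≤ k) :
    (∃! μ : YoungDiagram, μ.IsKappa (2 * k - 1) (2 * k) (2 * k + 1)) ∧
      ∀ μ : YoungDiagram, μ.IsKappa (2 * k - 1) (2 * k) (2 * k + 1) →
        μ.rowLens = squareParts k := by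
  obtain ⟨n, rfl⟩ := Nat.exists_eq_add_of_le' hk
  obtain ⟨κ, hκ⟩ : ∃ κ : YoungDiagram, κ.rowLens = squareParts (n + 1) :=
    ⟨_, YoungDiagram.rowLens_ofRowLens_eq_self (hw := squareParts_sortedGE _) (squareParts_pos _)⟩
  have hκg := betaSet_eq_gaps_of_rowLens hκ
  have huniq : ∀ μ : YoungDiagram,
      μ.IsKappa (2 * (n + 1) - 1) (2 * (n + 1)) (2 * (n + 1) + 1) → μ = κ := fun μ hμ =>
    YoungDiagram.betaSet_injective
      (((YoungDiagram.isKappa_iff_betaSet_eq_gaps ⟨κ, hκg⟩).1 hμ).trans hκg.symm)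
  refine ⟨⟨κ, (YoungDiagram.isKappa_iff_betaSet_eq_gaps ⟨κ, hκg⟩).2 hκg, huniq⟩, fun μ hμ => ?_⟩
  rw [huniq μ hμ, hκ]
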